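/- \textbf{Setting.} A binary-symmetric parallel-relay (BSPR) network with $K\ge 1$ relays consists of a source, relays $1,\dots,K$ and a destination. In network use $t$ the source sends a bit $U[t]$, relay $i$ receives $V_i[t]=U[t]\oplus Z_i[t]$ and sends a bit $X_i[t]$, and the destination receives $Y_i[t]=X_i[t]\oplus E_i[t]$ for $i=1,\dots,K$. All noise bits $Z_i[t],E_i[t]$ (over all $i$ and $t$) are independent, with $\Pr\{Z_i[t]=1\}=p_{s,i}\in[0,\tfrac12]$ and $\Pr\{E_i[t]=1\}=p_{i,d}\in[0,\tfrac12]$. An $(M,n)$ code consists of a source encoder mapping a message $W\in\{0,\dots,M-1\}$ to $(U[1],\dots,U[n])$, relay encoders $X_i[t]=f_{i,t}(V_i[1],\dots,V_i[t-1])$, and a destination decoder $\hat W=g\big((Y_i[t])_{i,t}\big)$; its rate is $(\log_2 M)/n$, and its average error probability is $P_{\mathrm e}=\frac1M\sum_w\Pr\{\hat W\ne w\mid W=w\}$. A rate $R$ is achievable if for every $\epsilon>0$ and all sufficiently large $n$ there is an $(M,n)$ code with $M\ge 2^{nR}$ and $P_{\mathrm e}\le\epsilon$. The capacity $C$ is the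 supremum of all achievable rates. Let $H(p)=-p\log_2 p-(1-p)\log_2(1-p)$ for $0<p\le\frac12$ and $H(0)=0$. \textbf{Coded transmission with decoding relays} (decode-and-forward) refers to the following codes of length $n\ge (B+1)\ell$. The message is $W=(W_1,\dots,W_B)$ with each $W_b\in\{1,\dots,m\}$ (so there are $m^B$ messages), and the first $(B+1)\ell$ network uses are divided into $B+1$ blocks of length $\ell$. In block $b\le B$ the source sends a codeword determined by $W_b$; at the end of that block every relay $i$ forms an estimate $\hat W_{i,b}$ of $W_b$ from what it received in block $b$, and in block $b+1$ it sends a codeword determined by $\hat W_{i,b}$; the destination decodes $W_b$ from what it received in block $b+1$. The codebooks and decoders are the same in all blocks, and nodes send $0$ when they have nothing to send. This scheme achieves the rate $R$ if for every $\epsilon>0$ and all sufficiently large $n$ there is such a code of length $n$ with $m^B\ge 2^{nR}$ for which the average error probability at the destination is at most $\epsilon$, and so is, for every relay $i$, the average probability that $(\hat W_{i,1},\dots,\hat W_{i,B})\ne W$. It achieves the capacity if the supremum of the rates that it achieves is $C$. \textbf{Theorem.} Consider a BSPR network with $K$ relays. \begin{enumerate} \item If $K=1$, then $C=1-\max\{H(p_{s,1}),H(p_{1,d})\}$,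 and coded transmission with decoding relays achieves the capacity. \item If $K>1$ and $K-\sum_{j=1}^K H(p_{j,d})\le 1-H(p_{s,i})$ for all $i\in\{1,\dots,K\}$, then $C=K-\sum_{i=1}^K H(p_{i,d})$, and coded transmission with decoding relays achieves the capacity. \end{enumerate} -/

import Mathlib

namespace BSPR

/-- The binary entropy function in bits, `H(p) = -p log₂ p - (1 - p) log₂ (1 - p)`, with
`H(0) = 0`. -/
noncomputable def H (p : ℝ) : ℝ := Real.binEntropy p / Real.log 2

theorem H_eq (p : ℝ) :
    H p = -(p * Real.logb 2 p) - (1 - p) * Real.logb 2 (1 - p) := by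
  simp only [H, Real.binEntropy, Real.logb, Real.log_inv]
  ring

/-- A binary-symmetric parallel-relay network with `K` relays, given by the cross-over
probabilities `ps i` of the channel from the source to relay `i` and `pd i` of the channel from
relay `i` to the destination. -/
structure Network (K : ℕ) where
  ps : Fin K → ℝ
  pd : Fin K → ℝ
  ps_mem : ∀ i, ps i ∈ Set.Icc (0 : ℝ) (1 / 2)
  pd_mem : ∀ i, pd i ∈ Set.Icc (0 : ℝ) (1 / 2)

/-- The bits seen (sent, received, or added as noise) on `K` links during `n` network uses. Bits
are elements of `ZMod 2`, so that `+` is modulo-two addition. -/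
abbrev Signals (K n : ℕ) : Type := Fin K → Fin n → ZMod 2

/-- A realization `(z, e)` of the channel noise in `n` network uses: `z i t` is the noise on the
channel from the source to relay `i` and `e i t` the noise on the channel from relay `i` to the
destination, at time `t`. -/
abbrev Noise (K n : ℕ) : Type := Signals K n × Signals K n

/-- The probability that a noise bit which is `1` with probability `p` takes the value `x`. -/
noncomputable def bitProb (p : ℝ) (x : ZMod 2) : ℝ := if x = 1 then p else 1 - p

/-- The probability of a noise realization: all noise bits are independent, over the channels and
over time. -/
noncomputable def Network.noiseProb {K n : ℕ} (net : Network K) (ω : Noise K n) : ℝ :=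
  ∏ i, ∏ t, bitProb (net.ps i) (ω.1 i t) * bitProb (net.pd i) (ω.2 i t)

/-- The probability of an event that is determined by the noise. -/
noncomputable def Network.prob {K n : ℕ} (net : Network K) (A : Set (Noise K n)) : ℝ :=
  ∑ ω, A.indicator net.noiseProb ω

/-- A code of length `n` for a network with `K` relays and message set `W`. At time `t` a relay
transmits a function of the bits that it received at the times before `t`. -/
structure Code (K : ℕ) (W : Type) (n : ℕ) where
  /-- the encoding function of the source -/
  enc : W → Fin n → ZMod 2
  /-- the encoding functions of the relays -/
  relay : (i : Fin K) → (t : Fin n) → (Fin (t : ℕ) → ZMod 2) → ZMod 2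
  /-- the decoding function of the destination -/
  dec : Signals K n → W

/-- `V_i[t] = U[t] ⊕ Z_i[t]`: what the relays receive when message `w` is sent. -/
def Code.relayIn {K n : ℕ} {W : Type} (c : Code K W n) (w : W) (ω : Noise K n) : Signals K n :=
  fun i t => c.enc w t + ω.1 i t

/-- `X_i[t]`: what the relays transmit when message `w` is sent. -/
def Code.relayOut {K n : ℕ} {W : Type} (c : Code K W n) (w : W) (ω : Noise K n) : Signals K n :=
  fun i t => c.relay i t fun s => c.relayIn w ω i ⟨s, s.isLt.trans t.isLt⟩

/-- `Y_i[t] = X_i[t] ⊕ E_i[t]`: what the destination receives when message `w` is sent. -/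
def Code.destIn {K n : ℕ} {W : Type} (c : Code K W n) (w : W) (ω : Noise K n) : Signals K n :=
  fun i t => c.relayOut w ω i t + ω.2 i t

/-- The average over all (equally likely) messages `w` of the probability of the event `A w`. -/
noncomputable def Network.avgProb {K n : ℕ} {W : Type} [Fintype W] (net : Network K)
    (A : W → Set (Noise K n)) : ℝ :=
  (1 / (Fintype.card W : ℝ)) * ∑ w, net.prob (A w)

/-- The average error probability of a code. -/
noncomputable def Network.errorProb {K n : ℕ} {W : Type} [Fintype W] (net : Network K)
    (c : Code K W n) : ℝ :=
  net.avgProb fun w => {ω | c.dec (c.destIn w ω) ≠ w}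

/-- The rate `R` is achievable: for every `ε > 0` and every sufficiently large `n` there is a code
of length `n` with at least `2 ^ (n R)` messages (that is, of rate at least `R`) and average error
probability at most `ε`. -/
def Network.Achievable {K : ℕ} (net : Network K) (R : ℝ) : Prop :=
  ∀ ε : ℝ, 0 < ε → ∃ N : ℕ, ∀ n : ℕ, N ≤ n →
    ∃ (M : ℕ) (c : Code K (Fin M) n), (2 : ℝ) ^ ((n : ℝ) * R) ≤ M ∧ net.errorProb c ≤ ε

/-- `C` is the capacity of the network: the supremum of all achievable rates. -/
def Network.IsCapacity {K : ℕ} (net : Network K) (C : ℝ) : Prop :=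
  IsLUB {R : ℝ | net.Achievable R} C

/-- The components of a decode-and-forward scheme (coded transmission with decoding relays) with
blocks of length `l` and `m` messages per block: in each block the source sends the codeword of a
block message; every relay decodes the block message from what it received in the block, and in the
next block it sends its own codeword for the decoded block message; from what it receives in that
next block the destination decodes the block message. -/
structure DFScheme (K m l : ℕ) where
  /-- the codebook of the source -/
  enc : Fin m → Fin l → ZMod 2
  /-- the decoding functions of the relays -/
  relayDec : Fin K → (Fin l → ZMod 2) → Fin m
  /-- the codebooks of the relays -/
  relayEnc : Fin K → Fin m → Fin l → ZMod 2
  /-- the decoding function of the destination -/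
  dec : Signals K l → Fin m

theorem block_lt {b B l n : ℕ} (hb : b < B) (hn : B * l ≤ n) (j : Fin l) : b * l + j < n := by
  have h1 : (b + 1) * l ≤ B * l := Nat.mul_le_mul_right l hb
  have h2 : (b + 1) * l = b * l + l := by ring
  have := j.isLt
  omega

theorem pos_of_div_pos {t l : ℕ} (h : 0 < t / l) : 0 < l := by
  rcases Nat.eq_zero_or_pos l with rfl | h1
  · simp at h
  · exact h1

theorem prev_block_lt {t l : ℕ} (h : 0 < t / l) (j : Fin l) : (t / l - 1) * l + j < t :=
  block_lt (Nat.sub_lt h one_pos) (Nat.div_mul_le_self t l) j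

/-- What arrives on a link during block `b`, i.e. at the times `b l, …, b l + l - 1` (times and
blocks are counted from `0`). -/
def block {n B l b : ℕ} (x : Fin n → ZMod 2) (hb : b < B) (hn : B * l ≤ n) : Fin l → ZMod 2 :=
  fun j => x ⟨b * l + j, block_lt hb hn j⟩

/-- The code of length `n ≥ (B + 1) l` obtained by running a decode-and-forward scheme over `B + 1`
blocks, to convey the message `(w 0, …, w (B - 1))`. The source sends `w b` in block `b` and
is silent (sends zeros) from block `B` on; the relays are silent in block `0`, forward the decoded
`w (b - 1)` in block `b` for `1 ≤ b ≤ B`, and are silent afterwards; the destination decodes `w b`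
from block `b + 1`. -/
def DFScheme.toCode {K m l : ℕ} (s : DFScheme K m l) (B n : ℕ) (hn : (B + 1) * l ≤ n) :
    Code K (Fin B → Fin m) n where
  enc w t :=
    if h : (t : ℕ) / l < B ∧ 0 < l then
      s.enc (w ⟨(t : ℕ) / l, h.1⟩) ⟨(t : ℕ) % l, Nat.mod_lt _ h.2⟩
    else 0
  relay i t v :=
    if h : 0 < (t : ℕ) / l ∧ (t : ℕ) / l ≤ B then
      s.relayEnc i (s.relayDec i fun j => v ⟨((t : ℕ) / l - 1) * l + j, prev_block_lt h.1 j⟩)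
        ⟨(t : ℕ) % l, Nat.mod_lt _ (pos_of_div_pos h.1)⟩
    else 0
  dec y b := s.dec fun i => block (y i) (Nat.succ_lt_succ b.isLt) hn

/-- The message that relay `i` has decoded when message `w` is sent. -/
def DFScheme.relayEstimate {K m l : ℕ} (s : DFScheme K m l) (B n : ℕ) (hn : (B + 1) * l ≤ n)
    (i : Fin K) (w : Fin B → Fin m) (ω : Noise K n) : Fin B → Fin m :=
  fun b => s.relayDec i
    (block ((s.toCode B n hn).relayIn w ω i) (b.isLt.trans (Nat.lt_succ_self B)) hn)

/-- The rate `R` is achieved by coded transmission with decoding relays: for every `ε > 0` and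
every sufficiently large `n` there is a decode-and-forward code of length `n` and rate at least `R`
such that the average error probabilities of the destination and of every relay are at most `ε`. -/
def Network.DFAchievable {K : ℕ} (net : Network K) (R : ℝ) : Prop :=
  ∀ ε : ℝ, 0 < ε → ∃ N : ℕ, ∀ n : ℕ, N ≤ n →
    ∃ (m l B : ℕ) (hn : (B + 1) * l ≤ n) (s : DFScheme K m l),
      (2 : ℝ) ^ ((n : ℝ) * R) ≤ (m : ℝ) ^ B ∧
      net.errorProb (s.toCode B n hn) ≤ ε ∧
      ∀ i, net.avgProb (fun w => {ω | s.relayEstimate B n hn i w ω ≠ w}) ≤ ε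

/-- `C` is the supremum of the rates achieved by coded transmission with decoding relays. -/
def Network.IsDFCapacity {K : ℕ} (net : Network K) (C : ℝ) : Prop :=
  IsLUB {R : ℝ | net.DFAchievable R} C

end BSPR

/-! The upper bounds are two cuts, both reduced to a strong converse for parallel binary symmetric
channels. Once the source-to-relay noise is fixed, the relay outputs depend on the message alone, so
the network is a code for the `K` links into the destination and `R ≤ K - ∑ H (pd i)`. Once the
relay-to-destination noise is fixed, relays and destination together form a decoder for the `K`
links out of the source, so `R ≤ K - ∑ H (ps i)`. The strong converse is a count: a noise value that
is not unusually likely has weight at most `γ`, and each channel output is correct for only one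
message.

For achievability (`Network.dfAchievable_of_lt`), random coding with a threshold decoder
(`exists_codebook`) gives a source codebook that every relay can decode when `R < 1 - H (ps i)`.
Relays that have all decoded the same message act as one transmitter with `K` parallel links, which
is reliable when `R < K - ∑ H (pd i)`. The one-block delay and the unused tail cost a factor that
tends to `1` as the number of blocks and then their length grow.

For `K = 1` the two cuts meet the two decoding conditions. In the second case the hypothesis says
that relay decoding is no bottleneck, and the destination cut suffices. -/

open Filter Topology

namespace BSPR

/-! ### Finite weight functions and their images -/

section Mass

variable {Ω Ω' : Type*} [Fintype Ω] [Fintype Ω']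

/-- The total weight of a set under a weight function on a finite type. -/
noncomputable def mass (P : Ω → ℝ) (A : Set Ω) : ℝ := ∑ x, A.indicator P x

theorem mass_nonneg {P : Ω → ℝ} (hP : ∀ x, 0 ≤ P x) (A : Set Ω) : 0 ≤ mass P A :=
  Finset.sum_nonneg fun x _ => Set.indicator_nonneg (fun x _ => hP x) x

/-- Null points are exempt from the inclusion, so arguments with logarithms may assume nonzero
probability. -/
theorem mass_mono {P : Ω → ℝ} (hP : ∀ x, 0 ≤ P x) {A B : Set Ω}
    (h : ∀ x ∈ A, P x ≠ 0 → x ∈ B) : mass P A ≤ mass P B := by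
  classical
  refine Finset.sum_le_sum fun x _ => ?_
  by_cases hA : x ∈ A
  · by_cases h0 : P x = 0
    · simp [Set.indicator_apply, h0]
    · simp [hA, h x hA h0]
  · simpa [hA] using Set.indicator_nonneg (fun x _ => hP x) x

theorem mass_union_le {P : Ω → ℝ} (hP : ∀ x, 0 ≤ P x) (A B : Set Ω) :
    mass P (A ∪ B) ≤ mass P A + mass P B := by
  classical
  rw [mass, mass, mass, ← Finset.sum_add_distrib]
  refine Finset.sum_le_sum fun x _ => ?_
  have := hP x
  by_cases hA : x ∈ A <;> by_cases hB : x ∈ B <;> simp [hA, hB, this]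

theorem mass_iUnion_le {ι : Type*} [Fintype ι] {P : Ω → ℝ} (hP : ∀ x, 0 ≤ P x)
    (A : ι → Set Ω) : mass P (⋃ i, A i) ≤ ∑ i, mass P (A i) := by
  classical
  simp only [mass]
  rw [Finset.sum_comm]
  refine Finset.sum_le_sum fun x _ => ?_
  have h0 : ∀ i, 0 ≤ (A i).indicator P x := fun i => Set.indicator_nonneg (fun x _ => hP x) x
  by_cases hx : ∃ i, x ∈ A i
  · obtain ⟨i, hi⟩ := hx
    rw [Set.indicator_of_mem (Set.mem_iUnion.2 ⟨i, hi⟩), ← Set.indicator_of_mem hi P]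
    exact Finset.single_le_sum (fun i _ => h0 i) (Finset.mem_univ i)
  · rw [Set.indicator_of_notMem (by simpa using hx)]
    exact Finset.sum_nonneg fun i _ => h0 i

theorem mass_compl (P : Ω → ℝ) (A : Set Ω) : mass P Aᶜ = ∑ x, P x - mass P A := by
  classical
  rw [mass, mass, ← Finset.sum_sub_distrib]
  refine Finset.sum_congr rfl fun x _ => ?_
  by_cases hA : x ∈ A <;> simp [hA]

/-- The weight function `Q` is the image of the weight function `P` under `f`. -/
def IsImage (P : Ω → ℝ) (f : Ω → Ω') (Q : Ω' → ℝ) : Prop :=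
  ∀ F : Ω' → ℝ, ∑ x, P x * F (f x) = ∑ y, Q y * F y

theorem IsImage.mass_preimage {P : Ω → ℝ} {f : Ω → Ω'} {Q : Ω' → ℝ} (h : IsImage P f Q)
    (A : Set Ω') : mass P (f ⁻¹' A) = mass Q A := by
  classical
  have := h (A.indicator 1)
  simp only [mass, Set.indicator_apply, Pi.one_apply, mul_ite, mul_one, mul_zero,
    Set.mem_preimage] at this ⊢
  exact this

theorem IsImage.comp {Ω'' : Type*} [Fintype Ω''] {P : Ω → ℝ} {f : Ω → Ω'} {Q : Ω' → ℝ}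
    {g : Ω' → Ω''} {S : Ω'' → ℝ} (hg : IsImage Q g S) (hf : IsImage P f Q) :
    IsImage P (g ∘ f) S := fun F => (hf (F ∘ g)).trans (hg F)

theorem isImage_equiv (e : Ω ≃ Ω') (Q : Ω' → ℝ) : IsImage (Q ∘ e) e Q := fun F =>
  e.sum_comp fun y => Q y * F y

theorem isImage_fst (P : Ω → ℝ) {Q : Ω' → ℝ} (hQ : ∑ y, Q y = 1) :
    IsImage (fun x : Ω × Ω' => P x.1 * Q x.2) Prod.fst P := fun F => by
  rw [Fintype.sum_prod_type]
  refine Finset.sum_congr rfl fun x _ => ?_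
  simp only [mul_right_comm (P x) _ (F x), ← Finset.mul_sum, hQ, mul_one]

theorem isImage_snd {P : Ω → ℝ} (Q : Ω' → ℝ) (hP : ∑ y, P y = 1) :
    IsImage (fun x : Ω × Ω' => P x.1 * Q x.2) Prod.snd Q := fun F => by
  rw [Fintype.sum_prod_type_right]
  refine Finset.sum_congr rfl fun x _ => ?_
  simp only [mul_assoc, ← Finset.sum_mul, hP, one_mul]

end Mass

/-! ### Product weights: marginals and Chebyshev's inequality -/

section Product

variable {ι κ α : Type*} [Fintype ι] [DecidableEq ι] [Fintype κ] [DecidableEq κ]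
  [Fintype α]

/-- The product of a family of weight functions. -/
def prodWeight (q : ι → α → ℝ) (x : ι → α) : ℝ := ∏ j, q j (x j)

theorem sum_prodWeight (q : ι → α → ℝ) : ∑ x, prodWeight q x = ∏ j, ∑ a, q j a :=
  (Fintype.prod_sum q).symm

theorem isImage_prodWeight_comp {q : ι → α → ℝ} (hq : ∀ j, ∑ a, q j a = 1) {φ : κ → ι}
    (hφ : Function.Injective φ) :
    IsImage (prodWeight q) (fun x => x ∘ φ) (prodWeight fun k => q (φ k)) := by
  classical
  have key : ∀ y : κ → α,
      ∑ x, prodWeight q x * (if x ∘ φ = y then 1 else 0) = prodWeight (fun k => q (φ k)) y := by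
    intro y
    -- The event `x ∘ φ = y` constrains each coordinate separately; absorbing its indicator into the
    -- factors makes the sum a product.
    let h : ι → α → ℝ := fun j a => q j a * if ∀ k, φ k = j → a = y k then 1 else 0
    have h1 : ∀ x, prodWeight q x * (if x ∘ φ = y then 1 else 0) = prodWeight h x := by
      intro x
      simp only [prodWeight, h, Finset.prod_mul_distrib]
      congr 1
      by_cases hx : x ∘ φ = y
      · rw [if_pos hx, Finset.prod_eq_one]
        rintro j -
        rw [if_pos]
        rintro k rfl
        exact congrFun hx k
      · rw [if_neg hx]
        obtain ⟨k, hk⟩ := Function.ne_iff.1 hx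
        refine (Finset.prod_eq_zero (Finset.mem_univ (φ k)) ?_).symm
        rw [if_neg]
        exact fun h => hk (h k rfl)
    rw [Finset.sum_congr rfl fun x _ => h1 x, sum_prodWeight, prodWeight]
    symm
    refine Fintype.prod_of_injective φ hφ _ _ ?_ ?_
    · intro j hj
      refine Eq.trans ?_ (hq j)
      refine Finset.sum_congr rfl fun a _ => ?_
      simp only [h]
      rw [if_pos, mul_one]
      exact fun k hk => absurd ⟨k, hk⟩ hj
    · intro k
      simp only [h, hφ.eq_iff, forall_eq, mul_ite, mul_one, mul_zero, Finset.sum_ite_eq',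
        Finset.mem_univ, if_true]
  intro F
  simp only [← key, Finset.sum_mul]
  rw [Finset.sum_comm]
  refine Finset.sum_congr rfl fun x _ => ?_
  simp

/-- Expand the square: independence and centring kill the off-diagonal terms. -/
theorem sum_prodWeight_mul_sq {q g : ι → α → ℝ} (hq : ∀ j, ∑ a, q j a = 1)
    (hg : ∀ j, ∑ a, q j a * g j a = 0) :
    ∑ x, prodWeight q x * (∑ j, g j (x j)) ^ 2 = ∑ j, ∑ a, q j a * g j a ^ 2 := by
  have key : ∀ j k, ∑ x, prodWeight q x * (g j (x j) * g k (x k)) =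
      if j = k then ∑ a, q j a * g j a ^ 2 else 0 := by
    intro j k
    let h : ι → α → ℝ := fun i a =>
      q i a * ((if i = j then g i a else 1) * (if i = k then g i a else 1))
    have h1 : ∀ x, prodWeight q x * (g j (x j) * g k (x k)) = prodWeight h x := by
      intro x
      simp only [prodWeight, h, Finset.prod_mul_distrib, Finset.prod_ite_eq', Finset.mem_univ,
        if_true]
    rw [Finset.sum_congr rfl fun x _ => h1 x, sum_prodWeight]
    split_ifs with hjk
    · subst hjk
      rw [Finset.prod_eq_single j]
      · simp [h, sq]
      · intro i _ hi
        simp [h, hi, hq]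
      · simp
    · refine Finset.prod_eq_zero (Finset.mem_univ j) ?_
      simpa [h, hjk] using hg j
  have h2 : ∀ x : ι → α, (∑ j, g j (x j)) ^ 2 = ∑ j, ∑ k, g j (x j) * g k (x k) := fun x => by
    rw [sq, Finset.sum_mul_sum]
  simp only [h2, Finset.mul_sum]
  rw [Finset.sum_comm]
  refine Finset.sum_congr rfl fun j _ => ?_
  rw [Finset.sum_comm]
  simp [key]

/-- Chebyshev's inequality for a sum of independent centred variables. -/
theorem mass_prodWeight_le_abs_sum {q g : ι → α → ℝ} (hq0 : ∀ j a, 0 ≤ q j a)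
    (hq : ∀ j, ∑ a, q j a = 1) (hg : ∀ j, ∑ a, q j a * g j a = 0) {c : ℝ} (hc : 0 < c) :
    mass (prodWeight q) {x | c ≤ |∑ j, g j (x j)|} ≤ (∑ j, ∑ a, q j a * g j a ^ 2) / c ^ 2 := by
  classical
  rw [← sum_prodWeight_mul_sq hq hg, mass, Finset.sum_div]
  refine Finset.sum_le_sum fun x _ => ?_
  have h0 : 0 ≤ prodWeight q x := Finset.prod_nonneg fun j _ => hq0 j _
  by_cases hx : c ≤ |∑ j, g j (x j)|
  · rw [Set.indicator_of_mem (s := {x : ι → α | c ≤ |∑ j, g j (x j)|}) hx, le_div_iff₀ (by positivity)]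
    refine mul_le_mul_of_nonneg_left ?_ h0
    rw [← sq_abs (∑ j, _)]
    gcongr
  · rw [Set.indicator_of_notMem (s := {x : ι → α | c ≤ |∑ j, g j (x j)|}) hx]
    positivity

end Product

/-! ### One-shot converse and random coding over a finite abelian group -/

section OneShot

/-- Threshold decoding: the decoded message is the only one for which the noise has probability
at least `γ`, if there is exactly one such message. -/
noncomputable def thresholdDec {G W : Type*} [AddCommGroup G] [Nonempty W] (P : G → ℝ) (γ : ℝ) (x : W → G) (y : G) : W :=
  Classical.epsilon fun w => γ ≤ P (y - x w) ∧ ∀ w', γ ≤ P (y - x w') → w' = w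

theorem thresholdDec_eq {G W : Type*} [AddCommGroup G] [Nonempty W] {P : G → ℝ} {γ : ℝ} {x : W → G} {y : G} {w : W}
    (h : γ ≤ P (y - x w)) (h' : ∀ w', γ ≤ P (y - x w') → w' = w) :
    thresholdDec P γ x y = w :=
  h' _ (Classical.epsilon_spec (p := fun w => γ ≤ P (y - x w) ∧ ∀ w', γ ≤ P (y - x w') → w' = w)
    ⟨w, h, h'⟩).1

variable {G W : Type*} [Fintype G] [AddCommGroup G] [Fintype W]

/-- Single-use converse for an additive-noise channel: the probability of correct decoding. -/
theorem sum_mass_correct_le {P : G → ℝ} (hP : ∀ e, 0 ≤ P e) (x : W → G) (d : G → W) {γ : ℝ}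
    (hγ : 0 ≤ γ) :
    ∑ w, mass P {e | d (x w + e) = w} ≤
      Fintype.card W * mass P {e | γ < P e} + Fintype.card G * γ := by
  classical
  -- Noise values of weight at most `γ` are charged `γ`. After translation by `x w` the charge is
  -- indexed by outputs `y`, and only `w = d y` pays for `y`.
  have h1 : ∀ w, mass P {e | d (x w + e) = w} ≤
      mass P {e | γ < P e} + ∑ e, if d (x w + e) = w then γ else 0 := by
    intro w
    rw [mass, mass, ← Finset.sum_add_distrib]
    refine Finset.sum_le_sum fun e _ => ?_
    have := hP e
    simp only [Set.indicator_apply, Set.mem_ofPred_eq]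
    split_ifs <;> linarith
  have h2 : ∀ w, (∑ e, if d (x w + e) = w then γ else 0) = ∑ y, if d y = w then γ else 0 :=
    fun w => Equiv.sum_comp (Equiv.addLeft (x w)) fun y => if d y = w then γ else 0
  calc _ ≤ ∑ w, (mass P {e | γ < P e} + ∑ y, if d y = w then γ else 0) :=
        Finset.sum_le_sum fun w _ => (h1 w).trans_eq (by rw [h2])
    _ = _ := by
        rw [Finset.sum_add_distrib, Finset.sum_comm]
        simp

/-- Pairwise independence of random codewords: shifting only the codeword of `w` permutes the
codebooks, so for `w' ≠ w` the argument `x w + e - x w'` is uniform on `G`. -/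
theorem sum_codebook_sub_add [DecidableEq W] (f : G → ℝ) (e : G) {w w' : W} (hw : w' ≠ w) :
    Fintype.card G * ∑ x : W → G, f (x w + e - x w') = Fintype.card (W → G) * ∑ g, f g := by
  classical
  have h1 : ∀ g : G, ∑ x : W → G, f (x w + e - x w') =
      ∑ x : W → G, f (g + (x w + e - x w')) := by
    intro g
    rw [← Equiv.sum_comp (Equiv.addLeft (Pi.single w g : W → G)) fun x => f (x w + e - x w')]
    refine Finset.sum_congr rfl fun x _ => ?_
    simp only [Equiv.coe_addLeft, Pi.add_apply, Pi.single_eq_same, Pi.single_eq_of_ne hw]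
    congr 1
    abel
  calc _ = ∑ _g : G, ∑ x : W → G, f (x w + e - x w') := by simp
    _ = ∑ x : W → G, ∑ g, f (g + (x w + e - x w')) := by
        rw [Finset.sum_comm (s := (Finset.univ : Finset (W → G)))]
        exact Finset.sum_congr rfl fun g _ => h1 g
    _ = ∑ _x : W → G, ∑ g, f g :=
        Finset.sum_congr rfl fun x _ => Equiv.sum_comp (Equiv.addRight (x w + e - x w')) f
    _ = _ := by simp

/-- An error requires that the true noise falls below `γ` or that a wrong message passes the test.
At most `1 / γ` group elements pass, and the residual of a wrong message is uniform, so the union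
bound applies. -/
theorem sum_codebook_error_le [DecidableEq W] [Nonempty W] {P : G → ℝ} (hP : ∀ e, 0 ≤ P e) (hP1 : ∑ e, P e = 1)
    {γ : ℝ} (hγ : 0 < γ) :
    ∑ x : W → G, ∑ w, mass P {e | thresholdDec P γ x (x w + e) ≠ w} ≤
      Fintype.card (W → G) * (Fintype.card W *
        (mass P {e | P e < γ} + Fintype.card W / (Fintype.card G * γ))) := by
  classical
  let f : G → ℝ := fun g => if γ ≤ P g then 1 else 0
  have hf0 : ∀ g, 0 ≤ f g := fun g => by simp only [f]; split_ifs <;> norm_num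
  have hf : ∑ g, f g ≤ 1 / γ := by
    rw [le_div_iff₀ hγ, Finset.sum_mul, ← hP1]
    refine Finset.sum_le_sum fun g _ => ?_
    simp only [f]
    split_ifs with h
    · simpa using h
    · simpa using hP g
  have hG : (0 : ℝ) < Fintype.card G := by exact_mod_cast Fintype.card_pos
  have h1 : ∀ (x : W → G) (w : W), mass P {e | thresholdDec P γ x (x w + e) ≠ w} ≤
      mass P {e | P e < γ} + ∑ w', ∑ e, P e * if w' ≠ w then f (x w + e - x w') else 0 := by
    intro x w
    rw [Finset.sum_comm, mass, mass, ← Finset.sum_add_distrib]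
    refine Finset.sum_le_sum fun e _ => ?_
    have hs : ∀ w', 0 ≤ P e * if w' ≠ w then f (x w + e - x w') else 0 := fun w' =>
      mul_nonneg (hP e) (by split_ifs; exacts [hf0 _, le_rfl])
    have hs' := Finset.sum_nonneg fun w' (_ : w' ∈ Finset.univ) => hs w'
    by_cases h2 : P e < γ
    · rw [Set.indicator_of_mem (s := {e | P e < γ}) h2]
      have := Set.indicator_le_self' (s := {e | thresholdDec P γ x (x w + e) ≠ w}) (f := P)
        (fun e _ => hP e) e
      linarith
    · rw [Set.indicator_of_notMem (s := {e | P e < γ}) h2, zero_add]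
      by_cases h3 : ∃ w', w' ≠ w ∧ γ ≤ P (x w + e - x w')
      · obtain ⟨w', hw', h3⟩ := h3
        refine (Set.indicator_le_self' (s := {e | thresholdDec P γ x (x w + e) ≠ w}) (f := P)
          (fun e _ => hP e) e).trans ?_
        refine le_trans ?_ (Finset.single_le_sum (fun w' _ => hs w') (Finset.mem_univ w'))
        simp [hw', f, h3]
      · rw [Set.indicator_of_notMem]
        · exact hs'
        · push Not at h3 h2
          simp only [Set.mem_ofPred_eq, not_not]
          refine thresholdDec_eq (by simpa using h2) fun w' hw' => ?_
          by_contra hne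
          exact absurd hw' (not_le.2 (h3 w' hne))
  have h2 : ∀ w w' : W, ∑ x : W → G, ∑ e, P e * (if w' ≠ w then f (x w + e - x w') else 0) ≤
      Fintype.card (W → G) * (1 / (Fintype.card G * γ)) := by
    intro w w'
    by_cases hw : w' ≠ w
    · rw [Finset.sum_comm]
      simp only [if_pos hw, ← Finset.mul_sum]
      have h3 : ∀ e, ∑ x : W → G, f (x w + e - x w') ≤
          Fintype.card (W → G) * (1 / (Fintype.card G * γ)) := by
        intro e
        have h4 := sum_codebook_sub_add f e hw
        have h5 : ∑ x : W → G, f (x w + e - x w') =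
            Fintype.card (W → G) * ((∑ g, f g) / Fintype.card G) := by
          field_simp
          linarith
        rw [h5]
        refine mul_le_mul_of_nonneg_left ?_ (Nat.cast_nonneg _)
        rw [mul_comm, ← div_div]
        gcongr
      refine (Finset.sum_le_sum fun e _ => mul_le_mul_of_nonneg_left (h3 e) (hP e)).trans_eq ?_
      rw [← Finset.sum_mul, hP1, one_mul]
    · simp only [if_neg hw, mul_zero, Finset.sum_const_zero]
      positivity
  calc _ ≤ ∑ x : W → G, ∑ w, (mass P {e | P e < γ} +
          ∑ w', ∑ e, P e * if w' ≠ w then f (x w + e - x w') else 0) :=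
        Finset.sum_le_sum fun x _ => Finset.sum_le_sum fun w _ => h1 x w
    _ = Fintype.card (W → G) * (Fintype.card W * mass P {e | P e < γ}) +
          ∑ w, ∑ w', ∑ x : W → G, ∑ e, P e * if w' ≠ w then f (x w + e - x w') else 0 := by
        simp only [Finset.sum_add_distrib, Finset.sum_const, Finset.card_univ, nsmul_eq_mul]
        congr 1
        rw [Finset.sum_comm]
        exact Finset.sum_congr rfl fun w _ => Finset.sum_comm
    _ ≤ Fintype.card (W → G) * (Fintype.card W * mass P {e | P e < γ}) +
          ∑ _w : W, ∑ _w' : W, Fintype.card (W → G) * (1 / (Fintype.card G * γ)) := by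
        gcongr with w _ w' _
        exact h2 w w'
    _ = _ := by
        simp only [Finset.sum_const, Finset.card_univ, nsmul_eq_mul]
        ring

/-- Random coding for finitely many additive-noise channels with a common codebook. -/
theorem exists_codebook [DecidableEq W] [Nonempty W] {J : Type*} [Fintype J] {P : J → G → ℝ}
    (hP : ∀ j e, 0 ≤ P j e) (hP1 : ∀ j, ∑ e, P j e = 1) {γ : J → ℝ} (hγ : ∀ j, 0 < γ j) :
    ∃ (x : W → G) (d : J → G → W), ∀ j,
      (1 / (Fintype.card W : ℝ)) * ∑ w, mass (P j) {e | d j (x w + e) ≠ w} ≤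
        ∑ j, (mass (P j) {e | P j e < γ j} + Fintype.card W / (Fintype.card G * γ j)) := by
  classical
  set b : J → ℝ := fun j =>
    mass (P j) {e | P j e < γ j} + Fintype.card W / (Fintype.card G * γ j)
  have h1 : ∑ x : W → G, ∑ j, ∑ w, mass (P j) {e | thresholdDec (P j) (γ j) x (x w + e) ≠ w} ≤
      ∑ _x : W → G, Fintype.card W * ∑ j, b j := by
    rw [Finset.sum_comm, Finset.sum_const, Finset.card_univ, nsmul_eq_mul, Finset.mul_sum,
      Finset.mul_sum]
    exact Finset.sum_le_sum fun j _ => sum_codebook_error_le (hP j) (hP1 j) (hγ j)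
  -- The averaged quantity is the sum of the errors over all channels, so one codebook is good for
  -- each of them.
  obtain ⟨x, -, hx⟩ := Finset.exists_le_of_sum_le Finset.univ_nonempty h1
  refine ⟨x, fun j => thresholdDec (P j) (γ j) x, fun j => ?_⟩
  have hW : (0 : ℝ) < Fintype.card W := by exact_mod_cast Fintype.card_pos
  rw [one_div_mul_eq_div, div_le_iff₀' hW]
  refine le_trans ?_ hx
  exact Finset.single_le_sum (f := fun j =>
    ∑ w, mass (P j) {e | thresholdDec (P j) (γ j) x (x w + e) ≠ w})
    (fun j _ => Finset.sum_nonneg fun w _ => mass_nonneg (hP j) _) (Finset.mem_univ j)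

end OneShot

/-! ### Self-information of a single noise bit -/

section Bit

theorem sum_zmod_two (f : ZMod 2 → ℝ) : ∑ a, f a = f 0 + f 1 := Fin.sum_univ_two f

theorem bitProb_nonneg {p : ℝ} (hp : p ∈ Set.Icc (0 : ℝ) 1) (a : ZMod 2) : 0 ≤ bitProb p a := by
  unfold bitProb
  split_ifs
  exacts [hp.1, sub_nonneg.2 hp.2]

theorem sum_bitProb (p : ℝ) : ∑ a, bitProb p a = 1 := by
  simp [sum_zmod_two, bitProb]

/-- The deviation of the self-information of a noise bit from the entropy. -/
noncomputable def infoDev (p : ℝ) (a : ZMod 2) : ℝ := -Real.logb 2 (bitProb p a) - H p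

theorem sum_bitProb_mul_infoDev (p : ℝ) : ∑ a, bitProb p a * infoDev p a = 0 := by
  simp [sum_zmod_two, bitProb, infoDev, H_eq]
  ring

/-- The variance of the self-information of a noise bit. -/
noncomputable def infoVar (p : ℝ) : ℝ := ∑ a, bitProb p a * infoDev p a ^ 2

end Bit

/-! ### Typical noise and coding theorems for parallel binary symmetric channels -/

section Sig

variable {A : Type*} [Fintype A] {n : ℕ}

/-- The probability of a noise realization on links with cross-over probabilities `p`. -/
noncomputable def sigProb (p : A → ℝ) (x : A → Fin n → ZMod 2) : ℝ :=
  ∏ a, ∏ t, bitProb (p a) (x a t)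

theorem sigProb_eq_prodWeight (p : A → ℝ) :
    (sigProb p : (A → Fin n → ZMod 2) → ℝ) =
      prodWeight (fun k : A × Fin n => bitProb (p k.1)) ∘ (Equiv.curry A (Fin n) (ZMod 2)).symm := by
  funext x
  simp [sigProb, prodWeight, Fintype.prod_prod_type]

theorem sigProb_nonneg {p : A → ℝ} (hp : ∀ a, p a ∈ Set.Icc (0 : ℝ) 1)
    (x : A → Fin n → ZMod 2) : 0 ≤ sigProb p x :=
  Finset.prod_nonneg fun a _ => Finset.prod_nonneg fun _ _ => bitProb_nonneg (hp a) _

theorem sum_infoDev {p : A → ℝ} {x : A → Fin n → ZMod 2} (hx : sigProb p x ≠ 0) :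
    ∑ a, ∑ t, infoDev (p a) (x a t) = -Real.logb 2 (sigProb p x) - n * ∑ a, H (p a) := by
  have h1 : ∀ a, ∏ t, bitProb (p a) (x a t) ≠ 0 := fun a =>
    Finset.prod_ne_zero_iff.1 hx a (Finset.mem_univ a)
  have h2 : ∀ a t, bitProb (p a) (x a t) ≠ 0 := fun a t =>
    Finset.prod_ne_zero_iff.1 (h1 a) t (Finset.mem_univ t)
  rw [sigProb, Real.logb_prod _ _ fun a _ => h1 a]
  simp only [infoDev, Finset.sum_sub_distrib, Finset.sum_neg_distrib, Finset.sum_const,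
    Finset.card_univ, Fintype.card_fin, nsmul_eq_mul, ← Finset.mul_sum]
  congr 2
  exact Finset.sum_congr rfl fun a _ => (Real.logb_prod _ _ fun t _ => h2 a t).symm

variable [DecidableEq A]

theorem isImage_uncurry (p : A → ℝ) :
    IsImage (sigProb p) (Equiv.curry A (Fin n) (ZMod 2)).symm
      (prodWeight fun k : A × Fin n => bitProb (p k.1)) := by
  rw [sigProb_eq_prodWeight]
  exact isImage_equiv _ _

theorem isImage_curry (p : A → ℝ) :
    IsImage (prodWeight fun k : A × Fin n => bitProb (p k.1)) (Equiv.curry A (Fin n) (ZMod 2))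
      (sigProb p) := by
  have := isImage_equiv (Equiv.curry A (Fin n) (ZMod 2)) (sigProb p)
  rw [sigProb_eq_prodWeight, Function.comp_assoc, Equiv.symm_comp_self, Function.comp_id] at this
  rwa [sigProb_eq_prodWeight]

theorem sum_sigProb (p : A → ℝ) : ∑ x : A → Fin n → ZMod 2, sigProb p x = 1 := by
  have := isImage_curry (n := n) p fun _ => 1
  simp only [mul_one] at this
  rw [← this, sum_prodWeight]
  simp [sum_bitProb]

/-- Allows one link, or one block of times, to be treated as a fresh channel of its own. -/
theorem isImage_sigProb {A' : Type*} [Fintype A'] [DecidableEq A'] {l : ℕ} (p : A → ℝ)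
    {f : A' → A} (hf : Function.Injective f) {τ : Fin l → Fin n} (hτ : Function.Injective τ) :
    IsImage (sigProb p) (fun x a j => x (f a) (τ j)) (sigProb fun a => p (f a)) := by
  have h := isImage_prodWeight_comp (q := fun k : A × Fin n => bitProb (p k.1))
    (fun k => sum_bitProb _) (hf.prodMap hτ)
  exact (isImage_curry fun a => p (f a)).comp (h.comp (isImage_uncurry p))

theorem mass_abs_infoDev_le {p : A → ℝ} (hp : ∀ a, p a ∈ Set.Icc (0 : ℝ) 1) {c : ℝ}
    (hc : 0 < c) :
    mass (sigProb p) {x : A → Fin n → ZMod 2 | c ≤ |∑ a, ∑ t, infoDev (p a) (x a t)|} ≤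
      n * (∑ a, infoVar (p a)) / c ^ 2 := by
  have h := mass_prodWeight_le_abs_sum (q := fun k : A × Fin n => bitProb (p k.1))
    (g := fun k : A × Fin n => infoDev (p k.1)) (fun k => bitProb_nonneg (hp k.1))
    (fun k => sum_bitProb _) (fun k => sum_bitProb_mul_infoDev _) hc
  rw [← (isImage_uncurry (n := n) p).mass_preimage] at h
  simp only [Fintype.sum_prod_type, Finset.sum_const, Finset.card_univ, Fintype.card_fin,
    nsmul_eq_mul, ← Finset.mul_sum] at h
  exact h

theorem tendsto_mass_abs_infoDev {p : A → ℝ} (hp : ∀ a, p a ∈ Set.Icc (0 : ℝ) 1) {δ : ℝ}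
    (hδ : 0 < δ) :
    Tendsto (fun n : ℕ => mass (sigProb p)
      {x : A → Fin n → ZMod 2 | n * δ ≤ |∑ a, ∑ t, infoDev (p a) (x a t)|}) atTop (𝓝 0) := by
  have h : Tendsto (fun n : ℕ => (∑ a, infoVar (p a)) / δ ^ 2 / (n : ℝ)) atTop (𝓝 0) :=
    tendsto_const_div_atTop_nhds_zero_nat _
  refine squeeze_zero' (Eventually.of_forall fun n => mass_nonneg (sigProb_nonneg hp) _) ?_ h
  filter_upwards [eventually_gt_atTop 0] with n hn
  have hn' : (0 : ℝ) < n := by exact_mod_cast hn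
  refine (mass_abs_infoDev_le hp (by positivity)).trans_eq ?_
  field_simp

/-- Asymptotic equipartition: atypically unlikely noise. -/
theorem tendsto_mass_sigProb_lt {p : A → ℝ} (hp : ∀ a, p a ∈ Set.Icc (0 : ℝ) 1) {δ : ℝ}
    (hδ : 0 < δ) :
    Tendsto (fun n : ℕ => mass (sigProb p) {x : A → Fin n → ZMod 2 |
      sigProb p x < (2 : ℝ) ^ (-(n * (∑ a, H (p a) + δ)))}) atTop (𝓝 0) := by
  refine squeeze_zero (fun n => mass_nonneg (sigProb_nonneg hp) _) (fun n => ?_)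
    (tendsto_mass_abs_infoDev hp hδ)
  refine mass_mono (sigProb_nonneg hp) fun x hx h0 => ?_
  have hpos := (sigProb_nonneg hp x).lt_of_ne' h0
  have h1 := (Real.logb_lt_iff_lt_rpow one_lt_two hpos).2 hx
  simp only [Set.mem_ofPred_eq, sum_infoDev h0]
  refine le_trans ?_ (le_abs_self _)
  linarith

/-- Asymptotic equipartition: atypically likely noise. -/
theorem tendsto_mass_lt_sigProb {p : A → ℝ} (hp : ∀ a, p a ∈ Set.Icc (0 : ℝ) 1) {δ : ℝ}
    (hδ : 0 < δ) :
    Tendsto (fun n : ℕ => mass (sigProb p) {x : A → Fin n → ZMod 2 |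
      (2 : ℝ) ^ (-(n * (∑ a, H (p a) - δ))) < sigProb p x}) atTop (𝓝 0) := by
  refine squeeze_zero (fun n => mass_nonneg (sigProb_nonneg hp) _) (fun n => ?_)
    (tendsto_mass_abs_infoDev hp hδ)
  refine mass_mono (sigProb_nonneg hp) fun x hx h0 => ?_
  have hpos := (sigProb_nonneg hp x).lt_of_ne' h0
  have h1 := (Real.lt_logb_iff_rpow_lt one_lt_two hpos).2 hx
  simp only [Set.mem_ofPred_eq, sum_infoDev h0]
  refine le_trans ?_ (neg_le_abs _)
  linarith

theorem tendsto_two_rpow_neg {δ : ℝ} (hδ : 0 < δ) :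
    Tendsto (fun n : ℕ => (2 : ℝ) ^ (-(n * δ))) atTop (𝓝 0) := by
  have h : ∀ n : ℕ, (2 : ℝ) ^ (-(n * δ)) = ((2 : ℝ) ^ (-δ)) ^ n := fun n => by
    rw [← Real.rpow_natCast, ← Real.rpow_mul zero_le_two]
    ring_nf
  simp only [h]
  exact tendsto_pow_atTop_nhds_zero_of_lt_one (by positivity)
    (Real.rpow_lt_one_of_one_lt_of_neg one_lt_two (neg_lt_zero.2 hδ))

theorem card_signals (A : Type*) [Fintype A] [DecidableEq A] (n : ℕ) :
    (Fintype.card (A → Fin n → ZMod 2) : ℝ) = (2 : ℝ) ^ ((n : ℝ) * Fintype.card A) := by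
  have h : Fintype.card (A → Fin n → ZMod 2) = 2 ^ (n * Fintype.card A) := by
    simp [pow_mul, ZMod.card]
  rw [h]
  push_cast
  rw [← Real.rpow_natCast]
  push_cast
  rfl

/-- Coding theorem for finitely many memoryless channels that share a codebook. -/
theorem eventually_exists_codebook {J : Type*} [Fintype J] {p : J → A → ℝ}
    (hp : ∀ j a, p j a ∈ Set.Icc (0 : ℝ) 1) {R : ℝ} (hR0 : 0 ≤ R)
    (hR : ∀ j, R < Fintype.card A - ∑ a, H (p j a)) {ε : ℝ} (hε : 0 < ε) :
    ∀ᶠ l : ℕ in atTop, ∃ (x : Fin ⌈(2 : ℝ) ^ (l * R)⌉₊ → A → Fin l → ZMod 2)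
      (d : J → (A → Fin l → ZMod 2) → Fin ⌈(2 : ℝ) ^ (l * R)⌉₊), ∀ j,
      (1 / (⌈(2 : ℝ) ^ (l * R)⌉₊ : ℝ)) *
        ∑ w, mass (sigProb (p j)) {e | d j (x w + e) ≠ w} ≤ ε := by
  -- Half of the gap to capacity goes to typicality; the other half leaves `2 ^ (-(l * δ j))` for
  -- wrong codewords.
  let δ : J → ℝ := fun j => (Fintype.card A - ∑ a, H (p j a) - R) / 2
  have hδ : ∀ j, 0 < δ j := fun j => by have := hR j; simp only [δ]; linarith
  have h1 : Tendsto (fun l : ℕ => ∑ j, (mass (sigProb (p j)) {x : A → Fin l → ZMod 2 |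
      sigProb (p j) x < (2 : ℝ) ^ (-(l * (∑ a, H (p j a) + δ j)))} +
        2 * (2 : ℝ) ^ (-(l * δ j)))) atTop (𝓝 (∑ _j : J, (0 + 2 * 0))) :=
    tendsto_finsetSum _ fun j _ => (tendsto_mass_sigProb_lt (hp j) (hδ j)).add
      ((tendsto_two_rpow_neg (hδ j)).const_mul 2)
  simp only [mul_zero, add_zero, Finset.sum_const_zero] at h1
  filter_upwards [h1.eventually_le_const hε] with l hl
  -- Here `0 ≤ R` matters: the ceiling is then at most twice the power, whence the factor `2` in
  -- `h1`.
  have hge : 1 ≤ (2 : ℝ) ^ (l * R) := Real.one_le_rpow one_le_two (by positivity)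
  have hpos : 0 < ⌈(2 : ℝ) ^ (l * R)⌉₊ := Nat.ceil_pos.2 (by linarith)
  have : Nonempty (Fin ⌈(2 : ℝ) ^ (l * R)⌉₊) := ⟨⟨0, hpos⟩⟩
  obtain ⟨x, d, h⟩ := exists_codebook (W := Fin ⌈(2 : ℝ) ^ (l * R)⌉₊)
    (P := fun j => (sigProb (p j) : (A → Fin l → ZMod 2) → ℝ))
    (fun j => sigProb_nonneg (hp j)) (fun j => sum_sigProb _)
    (γ := fun j => (2 : ℝ) ^ (-(l * (∑ a, H (p j a) + δ j)))) fun j => by positivity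
  refine ⟨x, d, fun j => ?_⟩
  have h2 := h j
  rw [Fintype.card_fin] at h2
  refine h2.trans (le_trans (Finset.sum_le_sum fun j _ => ?_) hl)
  gcongr
  rw [card_signals, ← Real.rpow_add two_pos, div_le_iff₀ (by positivity), mul_assoc,
    ← Real.rpow_add two_pos]
  have h3 : -((l : ℝ) * δ j) + (l * Fintype.card A + -(l * (∑ a, H (p j a) + δ j))) = l * R := by
    simp only [δ]
    ring
  rw [h3]
  linarith [(Nat.ceil_lt_add_one (zero_le_one.trans hge)).le]

/-- Strong converse: above capacity the probability of correct decoding vanishes. -/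
theorem eventually_avg_mass_correct_le {p : A → ℝ} (hp : ∀ a, p a ∈ Set.Icc (0 : ℝ) 1) {R : ℝ}
    (hR : Fintype.card A - ∑ a, H (p a) < R) {ε : ℝ} (hε : 0 < ε) :
    ∀ᶠ n : ℕ in atTop, ∀ (M : ℕ), (2 : ℝ) ^ ((n : ℝ) * R) ≤ M →
      ∀ (x : Fin M → A → Fin n → ZMod 2) (d : (A → Fin n → ZMod 2) → Fin M),
      (1 / (M : ℝ)) * ∑ w, mass (sigProb p) {e | d (x w + e) = w} ≤ ε := by
  -- Half of the excess rate, so that the number of outputs times the threshold is `2 ^ (n * R - n *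
  -- δ)`.
  let δ : ℝ := (R - (Fintype.card A - ∑ a, H (p a))) / 2
  have hδ : 0 < δ := by simp only [δ]; linarith
  have h1 := (tendsto_mass_lt_sigProb hp hδ).add (tendsto_two_rpow_neg hδ)
  rw [add_zero] at h1
  filter_upwards [h1.eventually_le_const hε] with n hn M hM x d
  have hM0 : (0 : ℝ) < M := lt_of_lt_of_le (by positivity) hM
  refine le_trans ?_ hn
  have h2 := sum_mass_correct_le (sigProb_nonneg hp) x d
    (γ := (2 : ℝ) ^ (-(n * (∑ a, H (p a) - δ)))) (by positivity)
  rw [one_div_mul_eq_div, div_le_iff₀' hM0, mul_add]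
  refine h2.trans ?_
  rw [Fintype.card_fin, card_signals, ← Real.rpow_add two_pos]
  gcongr
  have h3 : (n : ℝ) * Fintype.card A + -(n * (∑ a, H (p a) - δ)) = n * R + -(n * δ) := by
    simp only [δ]
    ring
  rw [h3, Real.rpow_add two_pos]
  gcongr

end Sig

/-! ### Conditioning and block marginals of the network noise -/

section NoiseLaw

variable {K n : ℕ} (net : Network K)

theorem Network.ps_mem_Icc (i : Fin K) : net.ps i ∈ Set.Icc (0 : ℝ) 1 :=
  ⟨(net.ps_mem i).1, (net.ps_mem i).2.trans (by norm_num)⟩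

theorem Network.pd_mem_Icc (i : Fin K) : net.pd i ∈ Set.Icc (0 : ℝ) 1 :=
  ⟨(net.pd_mem i).1, (net.pd_mem i).2.trans (by norm_num)⟩

theorem Network.noiseProb_eq :
    (net.noiseProb : Noise K n → ℝ) = fun ω => sigProb net.ps ω.1 * sigProb net.pd ω.2 := by
  funext ω
  simp only [Network.noiseProb, sigProb, Finset.prod_mul_distrib]

theorem Network.noiseProb_nonneg (ω : Noise K n) : 0 ≤ net.noiseProb ω := by
  rw [net.noiseProb_eq]
  exact mul_nonneg (sigProb_nonneg net.ps_mem_Icc _) (sigProb_nonneg net.pd_mem_Icc _)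

theorem Network.sum_noiseProb : ∑ ω : Noise K n, net.noiseProb ω = 1 := by
  have := isImage_fst (sigProb (n := n) net.ps) (sum_sigProb (n := n) net.pd) fun _ => 1
  simp only [mul_one] at this
  rw [net.noiseProb_eq, this, sum_sigProb]

theorem Network.prob_eq_mass (A : Set (Noise K n)) : net.prob A = mass net.noiseProb A := rfl

theorem Network.prob_eq_sum_fst (A : Set (Noise K n)) :
    net.prob A = ∑ z, sigProb net.ps z * mass (sigProb net.pd) {e | (z, e) ∈ A} := by
  classical
  rw [net.prob_eq_mass, mass, Fintype.sum_prod_type, net.noiseProb_eq]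
  refine Finset.sum_congr rfl fun z _ => ?_
  rw [mass, Finset.mul_sum]
  refine Finset.sum_congr rfl fun e _ => ?_
  simp [Set.indicator_apply]

theorem Network.prob_eq_sum_snd (A : Set (Noise K n)) :
    net.prob A = ∑ e, sigProb net.pd e * mass (sigProb net.ps) {z | (z, e) ∈ A} := by
  classical
  rw [net.prob_eq_mass, mass, Fintype.sum_prod_type_right, net.noiseProb_eq]
  refine Finset.sum_congr rfl fun z _ => ?_
  rw [mass, Finset.mul_sum]
  refine Finset.sum_congr rfl fun e _ => ?_
  simp [Set.indicator_apply, mul_comm]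

theorem block_injective {B l b : ℕ} (hb : b < B) (hn : B * l ≤ n) :
    Function.Injective fun j : Fin l => (⟨b * l + j, block_lt hb hn j⟩ : Fin n) := by
  intro j k h
  simpa [Fin.ext_iff] using h

theorem Network.isImage_relayNoise {B l b : ℕ} (hb : b < B) (hn : B * l ≤ n) (i : Fin K) :
    IsImage net.noiseProb (fun ω (_ : Unit) => block (ω.1 i) hb hn)
      (sigProb fun _ : Unit => net.ps i) := by
  rw [net.noiseProb_eq]
  exact (isImage_sigProb net.ps (f := fun _ : Unit => i) (fun _ _ _ => rfl)
    (block_injective hb hn)).comp (isImage_fst _ (sum_sigProb _))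

theorem Network.isImage_destNoise {B l b : ℕ} (hb : b < B) (hn : B * l ≤ n) :
    IsImage net.noiseProb (fun ω i => block (ω.2 i) hb hn) (sigProb net.pd) := by
  rw [net.noiseProb_eq]
  exact (isImage_sigProb net.pd (f := id) Function.injective_id
    (block_injective hb hn)).comp (isImage_snd _ (sum_sigProb _))

end NoiseLaw

/-! ### Cut-set bounds -/

section Converse

variable {K : ℕ} (net : Network K)

theorem Network.one_sub_errorProb {n M : ℕ} (hM : 0 < M) (c : Code K (Fin M) n) :
    1 - net.errorProb c =
      (1 / (M : ℝ)) * ∑ w, net.prob {ω | c.dec (c.destIn w ω) = w} := by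
  have h : ∀ w, net.prob {ω | c.dec (c.destIn w ω) ≠ w} =
      1 - net.prob {ω | c.dec (c.destIn w ω) = w} := fun w => by
    rw [net.prob_eq_mass, net.prob_eq_mass, ← net.sum_noiseProb, ← mass_compl]
    rfl
  have hM' : (M : ℝ) ≠ 0 := by exact_mod_cast hM.ne'
  simp only [Network.errorProb, Network.avgProb, h, Finset.sum_sub_distrib, Finset.sum_const,
    Finset.card_univ, Fintype.card_fin, nsmul_eq_mul, mul_one, mul_sub]
  field_simp
  ring

theorem mul_sum_mixture_le {Ω W : Type*} [Fintype Ω] [Fintype W] {q : Ω → ℝ} (hq : ∀ k, 0 ≤ q k)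
    (hq1 : ∑ k, q k = 1) {μ : Ω → W → ℝ} {a ε : ℝ} (h : ∀ k, a * ∑ w, μ k w ≤ ε) :
    a * ∑ w, ∑ k, q k * μ k w ≤ ε := by
  calc a * ∑ w, ∑ k, q k * μ k w = ∑ k, q k * (a * ∑ w, μ k w) := by
        rw [Finset.sum_comm, Finset.mul_sum]
        refine Finset.sum_congr rfl fun k _ => ?_
        rw [← Finset.mul_sum]
        ring
    _ ≤ ∑ k, q k * ε := Finset.sum_le_sum fun k _ => mul_le_mul_of_nonneg_left (h k) (hq k)
    _ = ε := by rw [← Finset.sum_mul, hq1, one_mul]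

variable {net}

/-- Error and success probabilities cannot both be at most `1 / 3`. -/
theorem Network.Achievable.le_of_eventually {R C : ℝ} (hR : net.Achievable R)
    (h : C < R → ∀ᶠ n : ℕ in atTop, ∀ (M : ℕ) (c : Code K (Fin M) n),
      (2 : ℝ) ^ ((n : ℝ) * R) ≤ M → 1 - net.errorProb c ≤ 1 / 3) : R ≤ C := by
  by_contra! hlt
  obtain ⟨N, hN⟩ := hR (1 / 3) (by norm_num)
  obtain ⟨n, h1, h2⟩ := ((h hlt).and (eventually_ge_atTop N)).exists
  obtain ⟨M, c, hM, hc⟩ := hN n h2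
  linarith [h1 M c hM]

/-- The cut that separates the destination from the relays. -/
theorem Network.Achievable.le_dest {R : ℝ} (hR : net.Achievable R) :
    R ≤ K - ∑ i, H (net.pd i) := by
  refine hR.le_of_eventually fun hlt => ?_
  have h := eventually_avg_mass_correct_le net.pd_mem_Icc (R := R) (by simpa using hlt)
    (ε := 1 / 3) (by norm_num)
  filter_upwards [h] with n hn M c hM
  have hM0 : 0 < M := by
    have : (0 : ℝ) < M := lt_of_lt_of_le (by positivity) hM
    exact_mod_cast this
  rw [net.one_sub_errorProb hM0]
  simp only [net.prob_eq_sum_fst]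
  exact mul_sum_mixture_le (sigProb_nonneg net.ps_mem_Icc) (sum_sigProb _) fun z =>
    hn M hM (fun w => c.relayOut w (z, 0)) c.dec

/-- The cut that separates the source from the relays. -/
theorem Network.Achievable.le_source {R : ℝ} (hR : net.Achievable R) :
    R ≤ K - ∑ i, H (net.ps i) := by
  refine hR.le_of_eventually fun hlt => ?_
  have h := eventually_avg_mass_correct_le net.ps_mem_Icc (R := R) (by simpa using hlt)
    (ε := 1 / 3) (by norm_num)
  filter_upwards [h] with n hn M c hM
  have hM0 : 0 < M := by
    have : (0 : ℝ) < M := lt_of_lt_of_le (by positivity) hM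
    exact_mod_cast this
  rw [net.one_sub_errorProb hM0]
  simp only [net.prob_eq_sum_snd]
  -- The codeword repeats the source's word on all links; the decoder simulates the relays, adds the
  -- fixed `e`, and applies `c.dec`.
  exact mul_sum_mixture_le (sigProb_nonneg net.pd_mem_Icc) (sum_sigProb _) fun e =>
    hn M hM (fun w _ => c.enc w) fun v =>
      c.dec fun i t => c.relay i t (fun s => v i ⟨s, s.isLt.trans t.isLt⟩) + e i t

end Converse

/-! ### Decode-and-forward codes as ordinary codes -/

section Reindex

variable {K n : ℕ} {W W' : Type}

/-- The code obtained by renaming the messages. -/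
def Code.reindex (c : Code K W n) (σ : W ≃ W') : Code K W' n where
  enc w := c.enc (σ.symm w)
  relay := c.relay
  dec y := σ (c.dec y)

theorem Network.errorProb_reindex [Fintype W] [Fintype W'] (net : Network K) (c : Code K W n)
    (σ : W ≃ W') : net.errorProb (c.reindex σ) = net.errorProb c := by
  rw [Network.errorProb, Network.errorProb, Network.avgProb, Network.avgProb,
    Fintype.card_congr σ, ← σ.sum_comp]
  congr 1
  refine Finset.sum_congr rfl fun w _ => ?_
  congr 1
  ext ω
  have h : (c.reindex σ).destIn (σ w) ω = c.destIn w ω := by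
    funext i t
    simp [Code.destIn, Code.relayOut, Code.relayIn, Code.reindex]
  simp only [Set.mem_ofPred_eq, h]
  simp [Code.reindex]

theorem Network.DFAchievable.achievable {net : Network K} {R : ℝ} (h : net.DFAchievable R) :
    net.Achievable R := by
  intro ε hε
  obtain ⟨N, hN⟩ := h ε hε
  refine ⟨N, fun n hn => ?_⟩
  obtain ⟨m, l, B, hl, s, h1, h2, -⟩ := hN n hn
  refine ⟨m ^ B, (s.toCode B n hl).reindex finFunctionFinEquiv, by exact_mod_cast h1, ?_⟩
  rwa [net.errorProb_reindex]

end Reindex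

/-! ### Error analysis of the block scheme -/

section Scheme

variable {K m l B n : ℕ} (s : DFScheme K m l) (hn : (B + 1) * l ≤ n)

theorem block_div_mod {t b : ℕ} (j : Fin l) (ht : t = b * l + j) : t / l = b ∧ t % l = j := by
  have hl : 0 < l := j.pos
  subst ht
  constructor
  · rw [mul_comm, Nat.mul_add_div hl, Nat.div_eq_of_lt j.isLt, add_zero]
  · rw [mul_comm, Nat.mul_add_mod, Nat.mod_eq_of_lt j.isLt]

theorem DFScheme.toCode_enc (w : Fin B → Fin m) (b : Fin B) (j : Fin l) {t : Fin n}
    (ht : (t : ℕ) = b * l + j) : (s.toCode B n hn).enc w t = s.enc (w b) j := by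
  obtain ⟨h1, h2⟩ := block_div_mod j ht
  have hl : 0 < l := j.pos
  simp only [DFScheme.toCode]
  rw [dif_pos ⟨h1 ▸ b.isLt, hl⟩]
  exact congrArg₂ s.enc (congrArg w (Fin.ext h1)) (Fin.ext h2)

theorem DFScheme.relayEstimate_eq (i : Fin K) (w : Fin B → Fin m) (ω : Noise K n) (b : Fin B) :
    s.relayEstimate B n hn i w ω b =
      s.relayDec i (s.enc (w b) + block (ω.1 i) (b.isLt.trans (Nat.lt_succ_self B)) hn) := by
  simp only [DFScheme.relayEstimate]
  congr 1
  funext j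
  simp only [block, Code.relayIn, Pi.add_apply]
  rw [s.toCode_enc hn w b j rfl]

theorem DFScheme.block_destIn (i : Fin K) (w : Fin B → Fin m) (ω : Noise K n) (b : Fin B) :
    block ((s.toCode B n hn).destIn w ω i) (Nat.succ_lt_succ b.isLt) hn =
      s.relayEnc i (s.relayEstimate B n hn i w ω b) +
        block (ω.2 i) (Nat.succ_lt_succ b.isLt) hn := by
  funext j
  simp only [block, Code.destIn, Pi.add_apply]
  congr 1
  obtain ⟨h1, h2⟩ := block_div_mod (t := b.val.succ * l + j) j rfl
  simp only [Code.relayOut]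
  conv_lhs => simp only [DFScheme.toCode]
  rw [dif_pos ⟨by rw [h1]; exact Nat.succ_pos _, by rw [h1]; exact b.isLt⟩]
  refine congrArg₂ (s.relayEnc i) (congrArg (s.relayDec i) (funext fun k => ?_)) (Fin.ext h2)
  refine congrArg ((s.toCode B n hn).relayIn w ω i) (Fin.ext ?_)
  -- In block `b + 1` the relay reads block `(b + 1) - 1`, which is `b`.
  simp only [h1]
  rfl

/-- The uniform law on message tuples is a product of uniform laws, so each block message is
uniform. -/
theorem avg_comp_apply (hm : 0 < m) (b : Fin B) (f : Fin m → ℝ) :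
    (1 / (Fintype.card (Fin B → Fin m) : ℝ)) * ∑ w : Fin B → Fin m, f (w b) =
      (1 / (m : ℝ)) * ∑ v, f v := by
  have hm' : (m : ℝ) ≠ 0 := by exact_mod_cast hm.ne'
  have h := isImage_prodWeight_comp (q := fun (_ : Fin B) (_ : Fin m) => 1 / (m : ℝ))
    (fun _ => by simp [hm']) (φ := fun _ : Unit => b) (fun _ _ _ => rfl) fun y => f (y ())
  rw [← (Equiv.funUnique Unit (Fin m)).symm.sum_comp] at h
  simp only [prodWeight, Finset.prod_const, Finset.card_univ, Fintype.card_fin,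
    Function.comp_apply, ← Finset.mul_sum, Fintype.card_unit, pow_one] at h
  simpa using h

variable (net : Network K)

theorem DFScheme.avgProb_relayEstimate_le (hm : 0 < m) {ε : ℝ} (i : Fin K)
    (h : (1 / (m : ℝ)) * ∑ v, mass (sigProb fun _ : Unit => net.ps i)
      {e : Unit → Fin l → ZMod 2 | s.relayDec i (s.enc v + e ()) ≠ v} ≤ ε) :
    net.avgProb (fun w => {ω | s.relayEstimate B n hn i w ω ≠ w}) ≤ B * ε := by
  have h1 : ∀ w, net.prob {ω | s.relayEstimate B n hn i w ω ≠ w} ≤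
      ∑ b, mass (sigProb fun _ : Unit => net.ps i)
        {e : Unit → Fin l → ZMod 2 | s.relayDec i (s.enc (w b) + e ()) ≠ w b} := by
    intro w
    have h2 : {ω | s.relayEstimate B n hn i w ω ≠ w} =
        ⋃ b : Fin B, {ω | s.relayEstimate B n hn i w ω b ≠ w b} := by
      ext ω
      simp [Function.ne_iff]
    rw [h2, net.prob_eq_mass]
    refine (mass_iUnion_le net.noiseProb_nonneg _).trans_eq (Finset.sum_congr rfl fun b _ => ?_)
    rw [← (net.isImage_relayNoise (b.isLt.trans (Nat.lt_succ_self B)) hn i).mass_preimage]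
    simp only [s.relayEstimate_eq]
    rfl
  calc _ ≤ (1 / (Fintype.card (Fin B → Fin m) : ℝ)) * ∑ w : Fin B → Fin m, ∑ b,
        mass (sigProb fun _ : Unit => net.ps i)
          {e : Unit → Fin l → ZMod 2 | s.relayDec i (s.enc (w b) + e ()) ≠ w b} := by
        refine mul_le_mul_of_nonneg_left (Finset.sum_le_sum fun w _ => h1 w) (by positivity)
    _ ≤ ∑ _b : Fin B, ε := by
        rw [Finset.sum_comm, Finset.mul_sum]
        refine Finset.sum_le_sum fun b _ => ?_
        exact (avg_comp_apply hm b fun v => mass (sigProb fun _ : Unit => net.ps i)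
          {e : Unit → Fin l → ZMod 2 | s.relayDec i (s.enc v + e ()) ≠ v}).trans_le h
    _ = B * ε := by simp

/-- When all relay estimates are right, the destination sees the true codewords plus noise. A union
bound over relay failures and over blocks suffices, with no independence between the two hops. -/
theorem DFScheme.errorProb_toCode_le (hm : 0 < m) {ε : ℝ}
    (h : (1 / (m : ℝ)) * ∑ v, mass (sigProb net.pd)
      {e : Signals K l | s.dec ((fun i => s.relayEnc i v) + e) ≠ v} ≤ ε) :
    net.errorProb (s.toCode B n hn) ≤
      ∑ i, net.avgProb (fun w => {ω | s.relayEstimate B n hn i w ω ≠ w}) + B * ε := by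
  have h1 : ∀ w, net.prob {ω | (s.toCode B n hn).dec ((s.toCode B n hn).destIn w ω) ≠ w} ≤
      ∑ i, net.prob {ω | s.relayEstimate B n hn i w ω ≠ w} +
      ∑ b, mass (sigProb net.pd)
        {e : Signals K l | s.dec ((fun i => s.relayEnc i (w b)) + e) ≠ w b} := by
    intro w
    have h2 : ∀ b : Fin B, mass (sigProb net.pd)
        {e : Signals K l | s.dec ((fun i => s.relayEnc i (w b)) + e) ≠ w b} =
        mass net.noiseProb {ω : Noise K n | s.dec ((fun i => s.relayEnc i (w b)) +
          fun i => block (ω.2 i) (Nat.succ_lt_succ b.isLt) hn) ≠ w b} := fun b => by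
      rw [← (net.isImage_destNoise (Nat.succ_lt_succ b.isLt) hn).mass_preimage]
      rfl
    simp only [h2, net.prob_eq_mass]
    refine le_trans ?_ (add_le_add (mass_iUnion_le net.noiseProb_nonneg _)
      (mass_iUnion_le net.noiseProb_nonneg _))
    refine le_trans ?_ (mass_union_le net.noiseProb_nonneg _ _)
    refine mass_mono net.noiseProb_nonneg fun ω hω _ => ?_
    by_contra hnot
    simp only [Set.mem_union, Set.mem_iUnion, Set.mem_ofPred_eq, not_or, not_exists,
      not_not] at hnot
    refine hω (funext fun b => ?_)
    refine Eq.trans ?_ (hnot.2 b)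
    change s.dec (fun i => block ((s.toCode B n hn).destIn w ω i) _ hn) = _
    congr 1
    funext i
    rw [s.block_destIn hn, hnot.1 i]
    rfl
  calc _ ≤ (1 / (Fintype.card (Fin B → Fin m) : ℝ)) * ∑ w : Fin B → Fin m,
        (∑ i, net.prob {ω | s.relayEstimate B n hn i w ω ≠ w} +
          ∑ b, mass (sigProb net.pd)
            {e : Signals K l | s.dec ((fun i => s.relayEnc i (w b)) + e) ≠ w b}) :=
        mul_le_mul_of_nonneg_left (Finset.sum_le_sum fun w _ => h1 w) (by positivity)
    _ ≤ ∑ i, net.avgProb (fun w => {ω | s.relayEstimate B n hn i w ω ≠ w}) +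
          ∑ _b : Fin B, ε := by
        rw [Finset.sum_add_distrib, mul_add, Finset.sum_comm, Finset.mul_sum, Finset.sum_comm,
          Finset.mul_sum]
        refine add_le_add le_rfl (Finset.sum_le_sum fun b _ => ?_)
        exact (avg_comp_apply hm b fun v => mass (sigProb net.pd)
          {e : Signals K l | s.dec ((fun i => s.relayEnc i v) + e) ≠ v}).trans_le h
    _ = _ := by simp

end Scheme

/-! ### Rates of decode-and-forward and the capacity -/

section Achievability

variable {K : ℕ} {net : Network K}

theorem Network.dfAchievable_of_nonpos {R : ℝ} (hR : R ≤ 0) : net.DFAchievable R := by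
  intro ε hε
  -- With no message blocks there is a single message, and no error is possible.
  refine ⟨0, fun n _ => ⟨1, 0, 0, by simp,
    ⟨fun _ _ => 0, fun _ _ => 0, fun _ _ _ => 0, fun _ => 0⟩, ?_, ?_, fun i => ?_⟩⟩
  · simpa using Real.rpow_le_one_of_one_le_of_nonpos one_le_two
      (mul_nonpos_of_nonneg_of_nonpos n.cast_nonneg hR)
  · refine le_trans (le_of_eq ?_) hε.le
    simp [Network.errorProb, Network.avgProb, Network.prob, eq_iff_true_of_subsingleton]
  · refine le_trans (le_of_eq ?_) hε.le
    simp [Network.avgProb, Network.prob, eq_iff_true_of_subsingleton]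

theorem Network.dfAchievable_of_lt {R : ℝ} (hd : R < K - ∑ i, H (net.pd i))
    (hs : ∀ i, R < 1 - H (net.ps i)) : net.DFAchievable R := by
  rcases le_or_gt R 0 with hR | hR
  · exact Network.dfAchievable_of_nonpos hR
  intro ε hε
  obtain ⟨R', hRR', hd', hs'⟩ : ∃ R', R < R' ∧ R' < K - ∑ i, H (net.pd i) ∧
      ∀ i, R' < 1 - H (net.ps i) := by
    have h : ∀ᶠ x in 𝓝[>] R, R < x ∧ x < K - ∑ i, H (net.pd i) ∧ ∀ i, x < 1 - H (net.ps i) := by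
      refine eventually_mem_nhdsWithin.and (Eventually.and ?_ (eventually_all.2 fun i => ?_))
      · exact nhdsWithin_le_nhds (eventually_lt_nhds hd)
      · exact nhdsWithin_le_nhds (eventually_lt_nhds (hs i))
    exact h.exists
  -- This makes `B * R'` exceed `(B + 1) * R`: the slack in the rate pays for the extra block.
  obtain ⟨B, hB⟩ := exists_nat_gt (R / (R' - R))
  rw [div_lt_iff₀ (sub_pos.2 hRR')] at hB
  have hB0 : (0 : ℝ) < B := by
    by_contra! h
    nlinarith
  -- The budget is shared by the `K` relays and the destination, over `B` blocks each.
  have hε' : 0 < ε / ((K + 1) * B) := by positivity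
  -- The first hop is `K` single-link channels sharing a codebook; the second, in `e2`, is one
  -- channel with `K` links.
  have e1 := eventually_exists_codebook (A := Unit) (J := Fin K) (p := fun i _ => net.ps i)
    (fun i _ => net.ps_mem_Icc i) (hR.trans hRR').le (by simpa using hs') hε'
  have e2 := eventually_exists_codebook (A := Fin K) (J := Unit) (p := fun _ => net.pd)
    (fun _ => net.pd_mem_Icc) (hR.trans hRR').le (by simpa using hd') hε'
  -- For such `l`, `l * B * R'` is at least `(l * (B + 1) + B) * R`, which covers the at most `B`
  -- leftover network uses.
  have e3 : ∀ᶠ l : ℕ in atTop, B * R / (B * (R' - R) - R) ≤ l :=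
    tendsto_natCast_atTop_atTop.eventually_ge_atTop _
  obtain ⟨L, hL⟩ := eventually_atTop.1 (e1.and (e2.and e3))
  refine ⟨L * (B + 1), fun n hn => ?_⟩
  obtain ⟨l, hln, hnl, hLl⟩ : ∃ l, (B + 1) * l ≤ n ∧ n < (B + 1) * (l + 1) ∧ L ≤ l :=
    ⟨n / (B + 1), Nat.mul_div_le n (B + 1), Nat.lt_mul_div_succ n B.succ_pos,
      (Nat.le_div_iff_mul_le B.succ_pos).2 hn⟩
  obtain ⟨⟨x, d, hx⟩, ⟨y, g, hy⟩, hl⟩ := hL l hLl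
  have hm : 0 < ⌈(2 : ℝ) ^ (l * R')⌉₊ := Nat.ceil_pos.2 (by positivity)
  let s : DFScheme K ⌈(2 : ℝ) ^ (l * R')⌉₊ l :=
    { enc := fun w => x w ()
      relayDec := fun i v => d i fun _ => v
      relayEnc := fun i w => y w i
      dec := fun v => g () v }
  have h1 : ∀ i, net.avgProb (fun w => {ω | s.relayEstimate B n hln i w ω ≠ w}) ≤
      B * (ε / ((K + 1) * B)) := fun i =>
    s.avgProb_relayEstimate_le hln net hm i (hx i)
  refine ⟨_, l, B, hln, s, ?_, ?_, fun i => (h1 i).trans ?_⟩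
  · have h2 : (2 : ℝ) ^ (l * R') ≤ ⌈(2 : ℝ) ^ (l * R')⌉₊ := Nat.le_ceil _
    refine le_trans ?_ (pow_le_pow_left₀ (by positivity) h2 B)
    rw [← Real.rpow_natCast, ← Real.rpow_mul zero_le_two]
    refine Real.rpow_le_rpow_of_exponent_le one_le_two ?_
    rw [div_le_iff₀ (by linarith)] at hl
    have h3 : n ≤ l * (B + 1) + B := by linarith
    have h4 : (n : ℝ) ≤ l * (B + 1) + B := by exact_mod_cast h3
    have h5 := mul_le_mul_of_nonneg_right h4 hR.le
    nlinarith
  · refine (s.errorProb_toCode_le hln net hm (hy ())).trans ?_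
    refine (add_le_add (Finset.sum_le_sum fun i _ => h1 i) le_rfl).trans_eq ?_
    simp only [Finset.sum_const, Finset.card_univ, Fintype.card_fin, nsmul_eq_mul]
    field_simp
  · rw [← mul_div_assoc, div_le_iff₀ (by positivity)]
    have : (0 : ℝ) ≤ K := K.cast_nonneg
    nlinarith [mul_nonneg (mul_nonneg this hB0.le) hε.le]

/-- Decode-and-forward reaches every rate below `C`, and its rates are achievable, so `hle` pins
both suprema to `C`. -/
theorem Network.isCapacity_and_isDFCapacity {C : ℝ} (hle : ∀ R, net.Achievable R → R ≤ C)
    (hd : C ≤ K - ∑ i, H (net.pd i)) (hs : ∀ i, C ≤ 1 - H (net.ps i)) :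
    net.IsCapacity C ∧ net.IsDFCapacity C := by
  have h : ∀ R < C, net.DFAchievable R := fun R hR =>
    Network.dfAchievable_of_lt (hR.trans_le hd) fun i => hR.trans_le (hs i)
  refine ⟨⟨fun R hR => hle R hR, fun b hb => ?_⟩, ⟨fun R hR => hle R hR.achievable,
    fun b hb => ?_⟩⟩
  · exact le_of_forall_lt_imp_le_of_dense fun R hR => hb (h R hR).achievable
  · exact le_of_forall_lt_imp_le_of_dense fun R hR => hb (h R hR)

end Achievability

end BSPR

theorem mainTheorem1 :
    (∀ net : BSPR.Network 1,
      net.IsCapacity (1 - max (BSPR.H (net.ps 0)) (BSPR.H (net.pd 0))) ∧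
      net.IsDFCapacity (1 - max (BSPR.H (net.ps 0)) (BSPR.H (net.pd 0)))) ∧
    (∀ (K : ℕ) (net : BSPR.Network K), 1 < K →
      (∀ i, (K : ℝ) - ∑ j, BSPR.H (net.pd j) ≤ 1 - BSPR.H (net.ps i)) →
      net.IsCapacity ((K : ℝ) - ∑ i, BSPR.H (net.pd i)) ∧
      net.IsDFCapacity ((K : ℝ) - ∑ i, BSPR.H (net.pd i))) := by
  refine ⟨fun net => ?_, fun K net _ h => ?_⟩
  · refine BSPR.Network.isCapacity_and_isDFCapacity (fun R hR => ?_) ?_ fun i => ?_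
    · have h1 := hR.le_dest
      have h2 := hR.le_source
      simp only [Nat.cast_one, Finset.univ_unique, Fin.default_eq_zero, Finset.sum_singleton]
        at h1 h2
      rw [le_sub_comm]
      exact max_le (by linarith) (by linarith)
    · simpa using sub_le_sub_left (le_max_right (BSPR.H (net.ps 0)) (BSPR.H (net.pd 0))) 1
    · rw [Subsingleton.elim i 0]
      exact sub_le_sub_left (le_max_left _ _) _
  · exact BSPR.Network.isCapacity_and_isDFCapacity (fun R hR => hR.le_dest) le_rfl h
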